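/- Let $p$ be a prime number and let $R$ be a regular ring of characteristic $p$, that is, a commutative Noetherian ring of characteristic $p$ all of whose localizations at prime ideals are regular local rings. Let $\mathfrak{a}$ and $I$ be nonzero proper ideals of $R$ with $\mathfrak{a} \subseteq \sqrt{I}$. For $i \ge 0$ let $$\mathfrak{a}^{(i)} = \bigcap_{\mathfrak{p} \in \operatorname{Ass}(R/\mathfrak{a})} \left(\mathfrak{a}^i R_{\mathfrak{p}} \cap R\right)$$ be the $i$-th symbolic power of $\mathfrak{a}$, and let $\mathfrak{a}^{(\bullet)} = \{\mathfrak{a}^{(i)}\}_{i \ge 0}$ be the filtration of symbolic powers. For $e \ge 0$ let $I^{[p^e]}$ be the ideal generated by all $x^{p^e}$ with $x \in I$, and put $$\nu(p^e) = \sup\{ r \in \mathbb{Z}_{\ge 0} : \mathfrak{a}^{(r)} \not\subseteq I^{[p^e]} \} \in \mathbb{R} \cup \{\pm\infty\}.$$ Then the symbolic $F$-threshold $\mathcal{C}^I(\mathfrak{a}^{(\bullet)})$ exists; that is, there is a real number $c \ge 0$ with $$\limsup_{e \to \infty} \frac{\nu(p^e)}{p^e} = \liminf_{e \to \infty} \frac{\nu(p^e)}{p^e}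 = c.$$ -/

import Mathlib

open Filter

/-- A filtration of ideals of `R`: a descending multiplicative sequence of ideals starting with the
unit ideal. -/
structure IdealFiltration (R : Type*) [CommRing R] where
  ideal : ℕ → Ideal R
  ideal_zero : ideal 0 = ⊤
  ideal_succ_le : ∀ i, ideal (i + 1) ≤ ideal i
  ideal_mul_le : ∀ i j, ideal i * ideal j ≤ ideal (i + j)

section Symbolic

variable {R : Type*} [CommRing R]

/-- `𝔟 R_𝔭 ∩ R`, the contraction to `R` of the extension of `𝔟` to the localization at `𝔭`. -/
def localContraction (b p : Ideal R) [p.IsPrime] : Ideal R :=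
  (b.map (algebraMap R (Localization.AtPrime p))).comap (algebraMap R (Localization.AtPrime p))

/-- The `i`-th symbolic power of `𝔞`: the intersection of `𝔞 ^ i R_𝔭 ∩ R` over all associated
primes `𝔭` of `𝔞` (that is, of the module `R ⧸ 𝔞`), including the embedded ones. -/
def symbolicPower (a : Ideal R) (i : ℕ) : Ideal R :=
  ⨅ p : {p : Ideal R // p ∈ associatedPrimes R (R ⧸ a)},
    haveI : (p : Ideal R).IsPrime := IsAssociatedPrime.isPrime p.2
    localContraction (a ^ i) (p : Ideal R)

/-- The filtration of symbolic powers of `𝔞`. -/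
def symbolicFiltration (a : Ideal R) : IdealFiltration R where
  ideal := symbolicPower a
  ideal_zero := by
    simp [symbolicPower, localContraction, Ideal.one_eq_top, Ideal.map_top]
  ideal_succ_le i := by
    refine iInf_mono fun p => ?_
    exact Ideal.comap_mono (Ideal.map_mono (Ideal.pow_le_pow_right (Nat.le_succ i)))
  ideal_mul_le i j := by
    refine le_iInf fun p => ?_
    have : (p : Ideal R).IsPrime := IsAssociatedPrime.isPrime p.2
    refine (Ideal.mul_mono (iInf_le _ p) (iInf_le _ p)).trans ?_
    refine (Ideal.le_comap_mul _).trans ?_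
    rw [← Ideal.map_mul, ← pow_add]
    exact le_rfl

end Symbolic

section FThreshold

variable {R : Type*} [CommRing R] (p : ℕ) [ExpChar R p]

/-- The Frobenius power `I^[p ^ e]`: the ideal generated by all `x ^ (p ^ e)` with `x ∈ I`,
equivalently by the `p ^ e`-th powers of any set of generators of `I`. -/
def frobeniusPower (I : Ideal R) (e : ℕ) : Ideal R :=
  I.map (iterateFrobenius R p e)

/-- `ν(p ^ e)`: the supremum of all `r` such that `𝔞_r` is not contained in `I^[p ^ e]`. It is
taken in the extended reals, so it is `⊤` for an unbounded set and `⊥` for the empty one. -/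
noncomputable def frobeniusNu (I : Ideal R) (a : IdealFiltration R) (e : ℕ) : EReal :=
  ⨆ r ∈ {r : ℕ | ¬ a.ideal r ≤ frobeniusPower p I e}, (r : EReal)

/-- The upper F-threshold, the limit superior of `ν(p ^ e) / p ^ e`. -/
noncomputable def upperFThreshold (I : Ideal R) (a : IdealFiltration R) : EReal :=
  limsup (fun e : ℕ => frobeniusNu p I a e / (((p : ℝ) ^ e : ℝ) : EReal)) atTop

/-- The lower F-threshold, the limit inferior of `ν(p ^ e) / p ^ e`. -/
noncomputable def lowerFThreshold (I : Ideal R) (a : IdealFiltration R) : EReal :=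
  liminf (fun e : ℕ => frobeniusNu p I a e / (((p : ℝ) ^ e : ℝ) : EReal)) atTop

/-- `c` is the F-threshold of the filtration `𝔞` with respect to `I`: it is a non-negative real
number which equals both the upper and the lower F-threshold. -/
def IsFThreshold (I : Ideal R) (a : IdealFiltration R) (c : ℝ) : Prop :=
  0 ≤ c ∧ upperFThreshold p I a = (c : EReal) ∧ lowerFThreshold p I a = (c : EReal)

end FThreshold

/-! Write `q = p ^ e`. The sequence `ν(q)/q` is nondecreasing and bounded, so it converges to its
supremum. Growth: if `x ∈ 𝔞^(r)` is not in `I^[q]`, then `x ^ p ∈ 𝔞^(pr)` is not in `I^[pq]`, since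
`x ^ p ∈ J^[p]` forces `x ∈ J`. Boundedness: by pigeonhole `𝔞 ^ (Nq) ⊆ 𝔞^[q]` with `N` independent
of `e`. An `s` regular on `R/𝔞` has `s ^ q` regular on `R/𝔞^[q]`, so the containment passes to
`𝔞^(Nq)`. Finally `𝔞^[p^n] ⊆ I` for some `n`. Both use `J^[p] : s ^ p ⊆ (J : s)^[p]`, a consequence
of flatness of Frobenius (Kunz). Flatness is proved in equational form on regular local rings, by
induction on the embedding dimension: relations lift from `R/(x)` to all powers of `x`, then to `R`
by Artin–Rees and Krull's intersection theorem. -/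

/-! ### Regular local rings: regular quotients and integrality -/

section RegularLocal

open IsLocalRing

variable {R : Type*} [CommRing R]

/-- Killing an element of `𝔪 \ 𝔪²` lowers the embedding dimension. -/
theorem spanFinrank_maximalIdeal_quotient_lt [IsLocalRing R] [IsNoetherianRing R] {x : R}
    (hx : x ∈ maximalIdeal R) (hx2 : x ∉ maximalIdeal R ^ 2)
    [IsLocalRing (R ⧸ Ideal.span {x})] :
    (maximalIdeal (R ⧸ Ideal.span {x})).spanFinrank + 1 ≤ (maximalIdeal R).spanFinrank := by
  classical
  have hfg : Submodule.FG (maximalIdeal R) := IsNoetherian.noetherian _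
  have hcard := hfg.generators_ncard
  have hfin := hfg.finite_generators
  have hspan := Submodule.span_generators (maximalIdeal R)
  set G := (maximalIdeal R).generators with hG
  obtain ⟨c, hc⟩ : ∃ c : R → R, ∑ g ∈ hfin.toFinset, c g * g = x := by
    have : x ∈ Submodule.span R (hfin.toFinset : Set R) := by
      rw [hfin.coe_toFinset, hspan]; exact hx
    obtain ⟨c, -, hc⟩ := Submodule.mem_span_finset.1 this
    exact ⟨c, hc⟩
  -- If every coefficient lay in `𝔪`, then `x` would lie in `𝔪²`. Modulo `x`, the generator `g` with
  -- unit coefficient becomes redundant.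
  obtain ⟨g, hg, hcg⟩ : ∃ g ∈ hfin.toFinset, IsUnit (c g) := by
    by_contra! h
    refine hx2 (hc ▸ Ideal.sum_mem _ fun g hg => ?_)
    rw [pow_two]
    refine Ideal.mul_mem_mul ((mem_maximalIdeal _).2 (h g hg)) ?_
    rw [← hspan]
    exact Submodule.subset_span (hfin.mem_toFinset.1 hg)
  have hgG : g ∈ G := hfin.mem_toFinset.1 hg
  have hmap : maximalIdeal (R ⧸ Ideal.span {x}) =
      Ideal.span (Ideal.Quotient.mk (Ideal.span {x}) '' (G \ {g})) := by
    have h1 : maximalIdeal (R ⧸ Ideal.span {x}) =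
        (maximalIdeal R).map (Ideal.Quotient.mk (Ideal.span {x})) :=
      (map_maximalIdeal_of_surjective _ Ideal.Quotient.mk_surjective).symm
    have h2 : maximalIdeal R = Ideal.span G := hspan.symm
    rw [h1, h2, Ideal.map_span]
    refine le_antisymm (Ideal.span_le.2 ?_) (Ideal.span_mono (Set.image_mono Set.sdiff_subset))
    rintro _ ⟨y, hy, rfl⟩
    by_cases hyg : y = g
    · subst hyg
      have h0 : Ideal.Quotient.mk (Ideal.span {x}) (∑ g ∈ hfin.toFinset, c g * g) = 0 := by
        rw [hc, Ideal.Quotient.eq_zero_iff_mem]; exact Ideal.mem_span_singleton_self x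
      rw [← Finset.add_sum_erase _ _ hg, map_add, add_eq_zero_iff_eq_neg, map_mul] at h0
      refine (Ideal.unit_mul_mem_iff_mem _ (hcg.map (Ideal.Quotient.mk (Ideal.span {x})))).1 ?_
      rw [h0, map_sum]
      refine neg_mem (Ideal.sum_mem _ fun z hz => ?_)
      rw [map_mul]
      refine Ideal.mul_mem_left _ _ (Ideal.subset_span ⟨z, ?_, rfl⟩)
      rw [Finset.mem_erase, hfin.mem_toFinset] at hz
      exact ⟨hz.2, hz.1⟩
    · exact Ideal.subset_span ⟨y, ⟨hy, hyg⟩, rfl⟩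
  rw [hmap]
  have h3 := Submodule.spanFinrank_span_le_ncard_of_finite (R := R ⧸ Ideal.span {x})
    ((hfin.subset (Set.sdiff_subset (t := {g}))).image (Ideal.Quotient.mk (Ideal.span {x})))
  have h4 := Set.ncard_image_le (f := Ideal.Quotient.mk (Ideal.span {x}))
    (hfin.subset (Set.sdiff_subset (t := {g})))
  have h5 := Set.ncard_sdiff_singleton_add_one hgG hfin
  have h6 : (Ideal.span (Ideal.Quotient.mk (Ideal.span {x}) '' (G \ {g}))).spanFinrank
    ≤ (Ideal.Quotient.mk (Ideal.span {x}) '' (G \ {g})).ncard := h3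
  omega

theorem exists_mem_maximalIdeal_isRegularLocalRing_quotient [IsRegularLocalRing R] {n : ℕ}
    (hn : (maximalIdeal R).spanFinrank = n + 1) :
    ∃ x ∈ maximalIdeal R, (∀ P ∈ minimalPrimes R, x ∉ P) ∧
      ∃ _ : IsRegularLocalRing (R ⧸ Ideal.span {x}),
        (maximalIdeal (R ⧸ Ideal.span {x})).spanFinrank = n := by
  have hdim : ringKrullDim R = (n + 1 : ℕ) := by
    rw [← hn]; exact IsRegularLocalRing.spanFinrank_maximalIdeal.symm
  have hfg : (maximalIdeal R).FG := IsNoetherian.noetherian _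
  have hbot : maximalIdeal R ≠ ⊥ := by
    intro h; rw [h] at hn; simp at hn
  obtain ⟨x, hx, hx2, hxP⟩ : ∃ x ∈ maximalIdeal R, x ∉ maximalIdeal R ^ 2 ∧
      ∀ P ∈ minimalPrimes R, x ∉ P := by
    by_contra! h
    have hfin : (insert (maximalIdeal R ^ 2) (minimalPrimes R)).Finite :=
      (minimalPrimes.finite_of_isNoetherianRing R).insert _
    have hsub : (maximalIdeal R : Set R) ⊆
        ⋃ i ∈ insert (maximalIdeal R ^ 2) (minimalPrimes R), ((id i : Ideal R) : Set R) := by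
      intro x hx
      by_cases hx2 : x ∈ maximalIdeal R ^ 2
      · exact Set.mem_biUnion (Set.mem_insert _ _) hx2
      · obtain ⟨P, hP, hxP⟩ := h x hx hx2
        exact Set.mem_biUnion (Set.mem_insert_of_mem _ hP) hxP
    -- Prime avoidance tolerates two non-prime ideals; `𝔪²` fills both places.
    obtain ⟨Q, hQ, hle⟩ := (Ideal.subset_union_prime_finite hfin (maximalIdeal R ^ 2)
      (maximalIdeal R ^ 2) (fun i hi hne _ => by
        rcases hi with rfl | hi
        · exact absurd rfl hne
        · exact hi.1.1)).1 hsub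
    rcases hQ with rfl | hQ
    · refine hbot (Submodule.eq_bot_of_le_smul_of_le_jacobson_bot (maximalIdeal R) _ hfg ?_
        (maximalIdeal_le_jacobson _))
      rw [smul_eq_mul, ← pow_two]; exact hle
    · have hQp : Q.IsPrime := hQ.1.1
      have hQm : Q = maximalIdeal R := le_antisymm (le_maximalIdeal hQp.ne_top) hle
      have h0 : (maximalIdeal R).height = 0 := by
        rw [Ideal.height_eq_zero_iff, ← hQm]; exact hQ
      have := maximalIdeal_height_eq_ringKrullDim (R := R)
      rw [h0, hdim] at this
      norm_cast at this
  have hne : Ideal.span {x} ≠ ⊤ := by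
    rw [Ne, Ideal.span_singleton_eq_top]; exact hx
  have : Nontrivial (R ⧸ Ideal.span {x}) := Ideal.Quotient.nontrivial_iff.2 hne
  have : IsLocalRing (R ⧸ Ideal.span {x}) :=
    IsLocalRing.of_surjective' (Ideal.Quotient.mk _) Ideal.Quotient.mk_surjective
  have h1 := spanFinrank_maximalIdeal_quotient_lt hx hx2
  rw [hn] at h1
  -- Dimension drops by at most one and embedding dimension by at least one, so equality holds
  -- throughout.
  have h2 : ringKrullDim R ≤ ringKrullDim (R ⧸ Ideal.span {x}) + 1 := by
    have := ringKrullDim_le_ringKrullDim_quotient_add_encard (R := R) {x}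
      (by simpa [IsLocalRing.ringJacobson_eq_maximalIdeal] using hx)
    simpa using this
  have h3 := ringKrullDim_le_spanFinrank_maximalIdeal (R := R ⧸ Ideal.span {x})
  have h4 : n + 1 ≤ (maximalIdeal (R ⧸ Ideal.span {x})).spanFinrank + 1 := by
    have : ((n + 1 : ℕ) : WithBot ℕ∞) ≤
        (((maximalIdeal (R ⧸ Ideal.span {x})).spanFinrank + 1 : ℕ) : WithBot ℕ∞) := by
      rw [← hdim]; push_cast; exact h2.trans (by gcongr)
    exact_mod_cast this
  have h5 : (maximalIdeal (R ⧸ Ideal.span {x})).spanFinrank = n := by omega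
  refine ⟨x, hx, hxP, IsRegularLocalRing.of_spanFinrank_maximalIdeal_le _ ?_, h5⟩
  rw [h5]
  rw [hdim] at h2
  generalize ringKrullDim (R ⧸ Ideal.span {x}) = d at h2
  push_cast at h2
  induction d with
  | bot => simp at h2
  | coe d =>
    norm_cast at h2 ⊢
    exact (ENat.add_le_add_iff_right ENat.one_ne_top).1 h2

end RegularLocal

/-- By induction `(x)` is prime. A minimal prime `Q ⊆ (x)` does not contain `x`, so `Q = xQ`, and
Nakayama gives `Q = 0`. -/
theorem IsRegularLocalRing.isDomain_of_spanFinrank_eq.{u} (n : ℕ) : ∀ (R : Type u) [CommRing R]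
    [IsRegularLocalRing R], (IsLocalRing.maximalIdeal R).spanFinrank = n → IsDomain R := by
  induction n with
  | zero =>
    intro R _ _ hn
    have hfg : (IsLocalRing.maximalIdeal R).FG := IsNoetherian.noetherian _
    have hbot : IsLocalRing.maximalIdeal R = ⊥ :=
      (Submodule.spanFinrank_eq_zero_iff_eq_bot hfg).1 hn
    exact (IsLocalRing.isField_iff_maximalIdeal_eq.2 hbot).isDomain
  | succ n ih =>
    intro R _ _ hn
    obtain ⟨x, hx, hxP, hreg, hn'⟩ := exists_mem_maximalIdeal_isRegularLocalRing_quotient hn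
    have hdom : IsDomain (R ⧸ Ideal.span {x}) := ih _ hn'
    have hprime : (Ideal.span {x}).IsPrime := (Ideal.Quotient.isDomain_iff_prime _).1 hdom
    obtain ⟨Q, hQ, hle⟩ := Ideal.exists_minimalPrimes_le (bot_le : ⊥ ≤ Ideal.span {x})
    have hQp : Q.IsPrime := hQ.1.1
    have hQbot : Q = ⊥ := by
      refine Submodule.eq_bot_of_le_smul_of_le_jacobson_bot (IsLocalRing.maximalIdeal R) _
        (IsNoetherian.noetherian _) ?_ (IsLocalRing.maximalIdeal_le_jacobson _)
      intro y hy
      obtain ⟨z, rfl⟩ := Ideal.mem_span_singleton'.1 (hle hy)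
      rw [mul_comm]
      exact Ideal.mul_mem_mul hx ((hQp.mem_or_mem hy).resolve_right (hxP Q hQ))
    exact IsDomain.of_bot_isPrime R (hbp := hQbot ▸ hQp)

theorem IsRegularLocalRing.isDomain (R : Type*) [CommRing R] [IsRegularLocalRing R] : IsDomain R :=
  isDomain_of_spanFinrank_eq _ R rfl

theorem charP_of_ringHom {R S : Type*} [CommRing R] [CommRing S] [Nontrivial S] (φ : R →+* S)
    (p : ℕ) [Fact p.Prime] [CharP R p] : CharP S p :=
  (CharP.charP_iff_prime_eq_zero Fact.out).2 (by rw [← map_natCast φ, CharP.cast_eq_zero, map_zero])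

/-! ### Equational flatness of Frobenius -/

section FrobeniusRelations

variable {R : Type*} [CommRing R] (p : ℕ)

/-- The submodule of `Rⁿ` generated by the coordinatewise `p`-th powers of those `a` with
`∑ fᵢ aᵢ ∈ Q`. -/
def frobeniusRelations {n : ℕ} (f : Fin n → R) (Q : Ideal R) : Submodule R (Fin n → R) :=
  Submodule.span R {v | ∃ a : Fin n → R, ∑ i, f i * a i ∈ Q ∧ v = fun i => a i ^ p}

/-- Flatness of the Frobenius endomorphism, in equational form. -/
def FrobeniusRelationsSpan (R : Type*) [CommRing R] (p : ℕ) : Prop :=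
  ∀ (n : ℕ) (f m : Fin n → R), ∑ i, f i ^ p * m i = 0 → m ∈ frobeniusRelations p f ⊥

variable {p}

theorem pow_mem_frobeniusRelations {n : ℕ} {f : Fin n → R} {Q : Ideal R} {a : Fin n → R}
    (h : ∑ i, f i * a i ∈ Q) : (fun i => a i ^ p) ∈ frobeniusRelations p f Q :=
  Submodule.subset_span ⟨a, h, rfl⟩

theorem pow_smul_mem_frobeniusRelations (hp : p ≠ 0) {n : ℕ} (f : Fin n → R) {Q : Ideal R} {c : R}
    (hc : c ∈ Q) (m : Fin n → R) : c ^ p • m ∈ frobeniusRelations p f Q := by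
  classical
  have key : ∀ i, (fun j => (Pi.single i c : Fin n → R) j ^ p) ∈ frobeniusRelations p f Q := by
    intro i
    refine pow_mem_frobeniusRelations (Ideal.sum_mem _ fun j _ => Ideal.mul_mem_left _ _ ?_)
    by_cases hij : j = i
    · subst hij; simpa using hc
    · simp [Pi.single_eq_of_ne hij]
  have : c ^ p • m = ∑ i, m i • (fun j => (Pi.single i c : Fin n → R) j ^ p) := by
    ext j
    simp only [Pi.smul_apply, smul_eq_mul, Finset.sum_apply]
    rw [Finset.sum_eq_single j]
    · simp [mul_comm]
    · intro i _ hij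
      simp [Pi.single_eq_of_ne hij.symm, hp]
    · simp
  rw [this]
  exact Submodule.sum_mem _ fun i _ => Submodule.smul_mem _ _ (key i)

theorem exists_add_smul_of_quotient {x : R} (hbar : FrobeniusRelationsSpan (R ⧸ Ideal.span {x}) p)
    {n : ℕ} {f m : Fin n → R} (h : ∑ i, f i ^ p * m i ∈ Ideal.span {x}) :
    ∃ w ∈ frobeniusRelations p f (Ideal.span {x}), ∃ m' : Fin n → R, m = w + x • m' := by
  set π := Ideal.Quotient.mk (Ideal.span {x}) with hπ
  have h1 : (fun i => π (m i)) ∈ frobeniusRelations p (fun i => π (f i)) ⊥ := by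
    refine hbar n _ _ ?_
    have := Ideal.Quotient.eq_zero_iff_mem.2 h
    simpa [hπ] using this
  have lift : ∀ v ∈ frobeniusRelations p (fun i => π (f i)) ⊥,
      ∃ w ∈ frobeniusRelations p f (Ideal.span {x}), ∀ i, π (w i) = v i := by
    intro v hv
    induction hv using Submodule.span_induction with
    | mem v hv =>
      obtain ⟨a, ha, rfl⟩ := hv
      choose b hb using fun i => Ideal.Quotient.mk_surjective (a i)
      refine ⟨fun i => b i ^ p, pow_mem_frobeniusRelations ?_, fun i => ?_⟩
      · rw [← Ideal.Quotient.eq_zero_iff_mem, map_sum]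
        simpa [hb] using ha
      · rw [map_pow]; exact congrArg (· ^ p) (hb i)
    | zero => exact ⟨0, zero_mem _, by simp⟩
    | add u v _ _ hu hv =>
      obtain ⟨w, hw, hw'⟩ := hu
      obtain ⟨z, hz, hz'⟩ := hv
      exact ⟨w + z, add_mem hw hz, fun i => by simp [hw', hz']⟩
    | smul r v _ hv =>
      obtain ⟨w, hw, hw'⟩ := hv
      obtain ⟨s, rfl⟩ := Ideal.Quotient.mk_surjective r
      exact ⟨s • w, Submodule.smul_mem _ _ hw, fun i => by
        rw [Pi.smul_apply, smul_eq_mul, map_mul, hw']; rfl⟩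
  obtain ⟨w, hw, hw'⟩ := lift _ h1
  have hmem : ∀ i, ∃ c, x * c = m i - w i := fun i => by
    have : m i - w i ∈ Ideal.span {x} := by
      rw [← Ideal.Quotient.eq_zero_iff_mem, map_sub, sub_eq_zero]
      exact (hw' i).symm
    obtain ⟨c, hc⟩ := Ideal.mem_span_singleton.1 this
    exact ⟨c, hc.symm⟩
  choose m' hm' using hmem
  exact ⟨w, hw, m', by ext i; simp [hm']⟩

variable [Fact p.Prime] [CharP R p]

theorem sum_pow_mul_mem_of_mem_frobeniusRelations {n : ℕ} {f : Fin n → R} {x : R}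
    {w : Fin n → R} (hw : w ∈ frobeniusRelations p f (Ideal.span {x})) :
    ∑ i, f i ^ p * w i ∈ Ideal.span {x ^ p} := by
  induction hw using Submodule.span_induction with
  | mem v hv =>
    obtain ⟨a, ha, rfl⟩ := hv
    simp_rw [← mul_pow]
    rw [← sum_pow_char p]
    rw [Ideal.mem_span_singleton] at ha ⊢
    exact pow_dvd_pow_of_dvd ha p
  | zero => simp
  | add u v _ _ hu hv =>
    simp only [Pi.add_apply, mul_add, Finset.sum_add_distrib]
    exact add_mem hu hv
  | smul r v _ hv =>
    have : ∑ i, f i ^ p * (r • v) i = r * ∑ i, f i ^ p * v i := by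
      rw [Finset.mul_sum]
      exact Finset.sum_congr rfl fun i _ => by simp [mul_left_comm]
    rw [this]
    exact Ideal.mul_mem_left _ _ hv

/-- The part `w` contributes only a multiple of `x ^ p` to the relation. While `k < p`, cancelling
`x ^ k` therefore leaves a relation on `m'` modulo `x`, and one more factor `x` can be extracted. -/
theorem exists_add_pow_smul_of_quotient {x : R} (hx : ∀ y, x * y = 0 → y = 0)
    (hbar : FrobeniusRelationsSpan (R ⧸ Ideal.span {x}) p) {n : ℕ} {f m : Fin n → R}
    (h : ∑ i, f i ^ p * m i = 0) (k : ℕ) (hk : k ≤ p) :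
    ∃ w ∈ frobeniusRelations p f (Ideal.span {x}), ∃ m' : Fin n → R, m = w + x ^ k • m' := by
  induction k with
  | zero => exact ⟨0, zero_mem _, m, by simp⟩
  | succ k ih =>
    obtain ⟨w, hw, m', rfl⟩ := ih (by omega)
    have hxk : ∀ y, x ^ k * y = 0 → y = 0 := by
      clear h ih
      intro y hy
      induction k with
      | zero => simpa using hy
      | succ k ih => exact ih (by omega) (hx _ (by rw [← hy]; ring))
    have h1 : ∑ i, f i ^ p * m' i ∈ Ideal.span {x} := by
      have h2 := sum_pow_mul_mem_of_mem_frobeniusRelations hw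
      have h3 : ∑ i, f i ^ p * w i + x ^ k * ∑ i, f i ^ p * m' i = 0 := by
        rw [← h, Finset.mul_sum, ← Finset.sum_add_distrib]
        exact Finset.sum_congr rfl fun i _ => by simp; ring
      obtain ⟨c, hc⟩ := Ideal.mem_span_singleton.1 h2
      obtain ⟨d, hd⟩ := Nat.exists_eq_add_of_le hk
      rw [hc] at h3
      have h4 : x ^ p = x ^ k * x * x ^ d := by
        conv_lhs => rw [hd]
        ring
      rw [h4] at h3
      have h5 := hxk (x * (x ^ d * c) + ∑ i, f i ^ p * m' i) (by rw [← h3]; ring)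
      rw [Ideal.mem_span_singleton]
      exact ⟨-(x ^ d * c), by linear_combination h5⟩
    obtain ⟨w', hw', m'', rfl⟩ := exists_add_smul_of_quotient hbar h1
    exact ⟨w + x ^ k • w', add_mem hw (Submodule.smul_mem _ _ hw'), m'', by
      rw [smul_add, smul_smul, ← pow_succ, add_assoc]⟩

theorem mem_frobeniusRelations_span_of_quotient {x : R} (hx : ∀ y, x * y = 0 → y = 0)
    (hbar : FrobeniusRelationsSpan (R ⧸ Ideal.span {x}) p) {n : ℕ} {f m : Fin n → R}
    (h : ∑ i, f i ^ p * m i = 0) : m ∈ frobeniusRelations p f (Ideal.span {x}) := by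
  obtain ⟨w, hw, m', rfl⟩ := exists_add_pow_smul_of_quotient hx hbar h p le_rfl
  exact add_mem hw (pow_smul_mem_frobeniusRelations (Fact.out : p.Prime).ne_zero f
    (Ideal.mem_span_singleton_self x) m')

/-- Write `m = ∑ y_j a_j ^ p` with `f · a_j = x ^ k b_j`. Cancelling `x ^ (kp)` gives `∑ b_j ^ p y_j
= 0`, so the case of exponent one applies to `y`. A vector `c` with `b · c ∈ (x)` yields `∑ c_j
a_j`, whose pairing with `f` is `x ^ k (b · c) ∈ (x ^ (k + 1))`. -/
theorem mem_frobeniusRelations_span_pow_of_quotient {x : R} (hx : ∀ y, x * y = 0 → y = 0)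
    (hbar : FrobeniusRelationsSpan (R ⧸ Ideal.span {x}) p) {n : ℕ} {f m : Fin n → R}
    (h : ∑ i, f i ^ p * m i = 0) (k : ℕ) :
    m ∈ frobeniusRelations p f (Ideal.span {x ^ k}) := by
  induction k with
  | zero =>
    have := pow_smul_mem_frobeniusRelations (Fact.out : p.Prime).ne_zero f
      (Ideal.mem_span_singleton_self (x ^ 0)) m
    simpa using this
  | succ k ih =>
    obtain ⟨l, y, g, hg⟩ := Submodule.mem_span_set'.1 ih
    choose a ha hga using fun j => (g j).2
    choose b hb using fun j => Ideal.mem_span_singleton.1 (ha j)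
    have hm : ∀ i, m i = ∑ j, y j * a j i ^ p := fun i => by
      rw [← hg]; simp [hga]
    have hxk : ∀ (N : ℕ) (z : R), x ^ N * z = 0 → z = 0 := by
      intro N
      induction N with
      | zero => intro z hz; simpa using hz
      | succ N ihN => exact fun z hz => ihN _ (hx _ (by rw [← hz]; ring))
    have hby : ∑ j, b j ^ p * y j = 0 := by
      refine hxk (k * p) _ ?_
      rw [← h, Finset.mul_sum]
      simp_rw [hm, Finset.mul_sum]
      rw [Finset.sum_comm]
      refine Finset.sum_congr rfl fun j _ => ?_
      rw [pow_mul, ← mul_assoc, ← mul_pow, ← hb j, sum_pow_char p, Finset.sum_mul]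
      exact Finset.sum_congr rfl fun i _ => by ring
    have hy := mem_frobeniusRelations_span_of_quotient hx hbar hby
    have key : ∀ v ∈ frobeniusRelations p b (Ideal.span {x}),
        (∑ j, v j • fun i => a j i ^ p) ∈ frobeniusRelations p f (Ideal.span {x ^ (k + 1)}) := by
      intro v hv
      induction hv using Submodule.span_induction with
      | mem v hv =>
        obtain ⟨c, hc, rfl⟩ := hv
        have : (∑ j, c j ^ p • fun i => a j i ^ p) = fun i => (∑ j, c j * a j i) ^ p := by
          ext i
          simp [sum_pow_char p, mul_pow]
        rw [this]
        refine pow_mem_frobeniusRelations ?_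
        have h6 : ∑ i, f i * ∑ j, c j * a j i = x ^ k * ∑ j, b j * c j := by
          simp_rw [Finset.mul_sum]
          rw [Finset.sum_comm]
          refine Finset.sum_congr rfl fun j _ => ?_
          rw [← mul_assoc, ← hb j, Finset.sum_mul]
          exact Finset.sum_congr rfl fun i _ => by ring
        rw [h6, Ideal.mem_span_singleton, pow_succ]
        exact mul_dvd_mul_left _ (Ideal.mem_span_singleton.1 hc)
      | zero => simp
      | add u v _ _ hu hv =>
        simp only [Pi.add_apply, add_smul, Finset.sum_add_distrib]
        exact add_mem hu hv
      | smul r v _ hv =>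
        simp only [Pi.smul_apply, smul_assoc]
        rw [← Finset.smul_sum]
        exact Submodule.smul_mem _ _ hv
    have := key y hy
    convert this using 1
    ext i
    simp [hm]

/-- By Artin–Rees, `f · a ∈ (x ^ (N + k))` equals `x ^ N (f · c)` for some `c`. Then `a - x ^ N c`
is an exact relation, and additivity of Frobenius splits `a ^ p`. -/
theorem frobeniusRelations_span_pow_le [IsNoetherianRing R] {n : ℕ} (f : Fin n → R) (x : R) :
    ∃ k, ∀ N, frobeniusRelations p f (Ideal.span {x ^ (N + k)}) ≤
      frobeniusRelations p f ⊥ ⊔ Ideal.span {x} ^ N • ⊤ := by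
  obtain ⟨k, hk⟩ := (Ideal.span {x}).exists_pow_inf_eq_pow_smul (Ideal.span (Set.range f))
  refine ⟨k, fun N => Submodule.span_le.2 ?_⟩
  rintro _ ⟨a, ha, rfl⟩
  have h1 : ∑ i, f i * a i ∈ Ideal.span {x} ^ (N + k) • (⊤ : Ideal R) ⊓ Ideal.span (Set.range f) := by
    refine ⟨by simpa [Ideal.span_singleton_pow] using ha, Ideal.sum_mem _ fun i _ =>
      Ideal.mul_mem_right _ _ (Ideal.subset_span ⟨i, rfl⟩)⟩
  rw [hk _ (by omega), Nat.add_sub_cancel, Ideal.span_singleton_pow] at h1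
  have h2 := Submodule.smul_mono (le_refl (Ideal.span {x ^ N}))
    (inf_le_right : Ideal.span {x} ^ k • ⊤ ⊓ Ideal.span (Set.range f) ≤ _) h1
  rw [smul_eq_mul, Ideal.mem_span_singleton_mul] at h2
  obtain ⟨z, hz, hz'⟩ := h2
  obtain ⟨c, hc⟩ := (Ideal.mem_span_range_iff_exists_fun).1 hz
  have h3 : (fun i => a i ^ p) = (fun i => (a i - x ^ N * c i) ^ p) +
      x ^ N • fun i => x ^ (N * (p - 1)) * c i ^ p := by
    ext i
    have hp1 : N * p = N + N * (p - 1) := by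
      obtain ⟨q, hq⟩ := Nat.exists_eq_succ_of_ne_zero (Fact.out : p.Prime).ne_zero
      subst hq; simp; ring
    simp only [Pi.add_apply, Pi.smul_apply, smul_eq_mul, sub_pow_char, mul_pow]
    rw [← pow_mul, hp1]
    ring
  rw [h3]
  refine Submodule.add_mem_sup (pow_mem_frobeniusRelations ?_) ?_
  · rw [Ideal.mem_bot]
    simp only [mul_sub, Finset.sum_sub_distrib]
    rw [← hz', ← hc, Finset.mul_sum, sub_eq_zero]
    exact Finset.sum_congr rfl fun i _ => by ring
  · rw [Ideal.span_singleton_pow]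
    exact Submodule.smul_mem_smul (Ideal.mem_span_singleton_self _) trivial

theorem FrobeniusRelationsSpan.of_quotient [IsLocalRing R] [IsNoetherianRing R] {x : R}
    (hxm : x ∈ IsLocalRing.maximalIdeal R) (hx : ∀ y, x * y = 0 → y = 0)
    (hbar : FrobeniusRelationsSpan (R ⧸ Ideal.span {x}) p) : FrobeniusRelationsSpan R p := by
  intro n f m h
  obtain ⟨k, hk⟩ := frobeniusRelations_span_pow_le (p := p) f x
  have hne : Ideal.span {x} ≠ ⊤ := by
    rw [Ne, Ideal.span_singleton_eq_top]; exact hxm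
  -- Krull's intersection theorem on the quotient by the exact relations absorbs the error terms in
  -- `x ^ N`.
  have hbot := Ideal.iInf_pow_smul_eq_bot_of_isLocalRing
    (M := (Fin n → R) ⧸ frobeniusRelations p f ⊥) (Ideal.span {x}) hne
  rw [← Submodule.Quotient.mk_eq_zero, ← Submodule.mem_bot R, ← hbot, Submodule.mem_iInf]
  intro N
  obtain ⟨w, hw, u, hu, rfl⟩ := Submodule.mem_sup.1
    (hk N (mem_frobeniusRelations_span_pow_of_quotient hx hbar h (N + k)))
  rw [Submodule.Quotient.mk_add, (Submodule.Quotient.mk_eq_zero _).2 hw, zero_add]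
  have := Submodule.mem_map_of_mem (f := (frobeniusRelations p f ⊥).mkQ) hu
  rw [Submodule.map_smul''] at this
  exact Submodule.smul_mono le_rfl le_top this

theorem FrobeniusRelationsSpan.of_forall_eq_zero_or_isUnit (hR : ∀ r : R, r = 0 ∨ IsUnit r) :
    FrobeniusRelationsSpan R p := by
  classical
  intro n f m h
  have hp : p ≠ 0 := (Fact.out : p.Prime).ne_zero
  by_cases hf : ∀ i, f i = 0
  · have := Submodule.sum_mem (frobeniusRelations p f ⊥) (t := Finset.univ)
      (f := fun i => m i • fun j => (Pi.single i 1 : Fin n → R) j ^ p)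
      fun i _ => Submodule.smul_mem _ _ (pow_mem_frobeniusRelations (by simp [hf]))
    convert this using 1
    ext j
    simp [Finset.sum_apply, Pi.single_apply, ite_pow, hp]
  · push Not at hf
    obtain ⟨k, hk⟩ := hf
    obtain ⟨u, hu⟩ := ((hR (f k)).resolve_left hk).exists_left_inv
    -- The vectors `e_i - u f_i e_k` are relations on `f`. Weighting their `p`-th powers by `m_i`
    -- recovers `m`, because the `e_k` terms sum to a multiple of `∑ f_i ^ p m_i = 0`.
    have := Submodule.sum_mem (frobeniusRelations p f ⊥) (t := Finset.univ)
      (f := fun i => m i • fun j =>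
        ((Pi.single i 1 : Fin n → R) j - u * f i * (Pi.single k 1 : Fin n → R) j) ^ p)
      fun i _ => Submodule.smul_mem _ _ (pow_mem_frobeniusRelations (by
        simp only [mul_sub, Finset.sum_sub_distrib, Ideal.mem_bot, Pi.single_apply, mul_ite,
          mul_one, mul_zero, Finset.sum_ite_eq', Finset.mem_univ, if_true]
        linear_combination (-f i) * hu))
    convert this using 1
    ext j
    simp only [Finset.sum_apply, Pi.smul_apply, smul_eq_mul, sub_pow_char, mul_sub,
      Finset.sum_sub_distrib, mul_pow _ ((Pi.single k 1 : Fin n → R) j)]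
    have h3 : ∀ i, m i * ((u * f i) ^ p * (Pi.single k 1 : Fin n → R) j ^ p) =
        u ^ p * (Pi.single k 1 : Fin n → R) j ^ p * (f i ^ p * m i) := fun i => by ring
    simp only [h3]
    rw [← Finset.mul_sum, h]
    simp [Pi.single_apply, ite_pow, hp]

end FrobeniusRelations

theorem IsRegularLocalRing.frobeniusRelationsSpan_of_spanFinrank_eq.{u} (p : ℕ) [Fact p.Prime]
    (n : ℕ) : ∀ (R : Type u) [CommRing R] [IsRegularLocalRing R] [CharP R p],
      (IsLocalRing.maximalIdeal R).spanFinrank = n → FrobeniusRelationsSpan R p := by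
  induction n with
  | zero =>
    intro R _ _ _ hn
    have hfg : (IsLocalRing.maximalIdeal R).FG := IsNoetherian.noetherian _
    have hbot : IsLocalRing.maximalIdeal R = ⊥ :=
      (Submodule.spanFinrank_eq_zero_iff_eq_bot hfg).1 hn
    refine FrobeniusRelationsSpan.of_forall_eq_zero_or_isUnit fun r => ?_
    by_cases hr : IsUnit r
    · exact Or.inr hr
    · have := (IsLocalRing.mem_maximalIdeal r).2 hr
      rw [hbot] at this
      exact Or.inl this
  | succ n ih =>
    intro R _ _ _ hn
    obtain ⟨x, hx, hxP, hreg, hn'⟩ := exists_mem_maximalIdeal_isRegularLocalRing_quotient hn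
    have := IsRegularLocalRing.isDomain R
    have hx0 : x ≠ 0 := by
      rintro rfl
      obtain ⟨Q, hQ⟩ := Ideal.nonempty_minimalPrimes (bot_ne_top (α := Ideal R))
      exact hxP Q hQ (zero_mem _)
    have hchar : CharP (R ⧸ Ideal.span {x}) p := charP_of_ringHom (Ideal.Quotient.mk _) p
    exact FrobeniusRelationsSpan.of_quotient hx
      (fun y hy => (mul_eq_zero.1 hy).resolve_left hx0) (ih _ hn')

theorem IsRegularLocalRing.frobeniusRelationsSpan (R : Type*) [CommRing R] [IsRegularLocalRing R]
    (p : ℕ) [Fact p.Prime] [CharP R p] : FrobeniusRelationsSpan R p :=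
  frobeniusRelationsSpan_of_spanFinrank_eq p _ R rfl

/-! ### Frobenius powers and colon ideals in regular rings -/

section FrobeniusColon

variable {R : Type*} [CommRing R] {p : ℕ} [Fact p.Prime] [CharP R p]

/-- An equation `s ^ p y = ∑ c_i f_i ^ p` is a relation on `(s ^ p, f_i ^ p)`. The generating
relations have first coordinate `a_0 ^ p` with `s a_0 ∈ J`. -/
theorem FrobeniusRelationsSpan.mem_map_colon [IsNoetherianRing R]
    (hR : FrobeniusRelationsSpan R p) {J : Ideal R} {s y : R}
    (h : s ^ p * y ∈ J.map (frobenius R p)) : y ∈ (J.colon {s}).map (frobenius R p) := by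
  obtain ⟨n, f, hf⟩ := Submodule.fg_iff_exists_fin_generating_family.1 (IsNoetherian.noetherian J)
  have hfJ : ∀ i, f i ∈ J := fun i => hf ▸ Submodule.subset_span ⟨i, rfl⟩
  have hJ : J.map (frobenius R p) = Ideal.span (Set.range fun i => f i ^ p) := by
    have : J = Ideal.span (Set.range f) := hf.symm
    rw [this, Ideal.map_span, ← Set.range_comp]; rfl
  rw [hJ, Ideal.mem_span_range_iff_exists_fun] at h
  obtain ⟨c, hc⟩ := h
  have h1 : (Fin.cons y (fun i => -c i) : Fin (n + 1) → R) ∈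
      frobeniusRelations p (Fin.cons s f : Fin (n + 1) → R) ⊥ := by
    refine hR _ _ _ ?_
    rw [Fin.sum_univ_succ]
    simp only [Fin.cons_zero, Fin.cons_succ]
    rw [← hc, ← Finset.sum_add_distrib]
    exact Finset.sum_eq_zero fun i _ => by ring
  have key : ∀ v ∈ frobeniusRelations p (Fin.cons s f : Fin (n + 1) → R) ⊥,
      v 0 ∈ (J.colon {s}).map (frobenius R p) := by
    intro v hv
    induction hv using Submodule.span_induction with
    | mem v hv =>
      obtain ⟨a, ha, rfl⟩ := hv
      refine Ideal.mem_map_of_mem (frobenius R p) ?_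
      rw [Ideal.mem_bot, Fin.sum_univ_succ] at ha
      simp only [Fin.cons_zero, Fin.cons_succ] at ha
      rw [Submodule.mem_colon_singleton, smul_eq_mul, mul_comm, eq_neg_of_add_eq_zero_left ha]
      exact neg_mem (Ideal.sum_mem _ fun i _ => Ideal.mul_mem_right _ _ (hfJ i))
    | zero => exact zero_mem _
    | add u v _ _ hu hv => exact add_mem hu hv
    | smul r v _ hv => exact Ideal.mul_mem_left _ _ hv
  exact key _ h1

theorem IsLocalization.colon_map_le {S : Type*} [CommRing S] [Algebra R S] (M : Submonoid R)
    [IsLocalization M S] (J : Ideal R) (s : R) :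
    (J.map (algebraMap R S)).colon {algebraMap R S s} ≤ (J.colon {s}).map (algebraMap R S) := by
  intro z hz
  obtain ⟨a, t, rfl⟩ := IsLocalization.exists_mk'_eq M z
  rw [Submodule.mem_colon_singleton, smul_eq_mul] at hz
  have h1 : algebraMap R S (a * s) ∈ J.map (algebraMap R S) := by
    have := Ideal.mul_mem_left _ (algebraMap R S t) hz
    rwa [← mul_assoc, IsLocalization.mk'_spec', ← map_mul] at this
  obtain ⟨u, hu, hus⟩ := (IsLocalization.algebraMap_mem_map_algebraMap_iff M S J _).1 h1
  have h2 : algebraMap R S a ∈ (J.colon {s}).map (algebraMap R S) := by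
    rw [IsLocalization.algebraMap_mem_map_algebraMap_iff M]
    exact ⟨u, hu, by rwa [Submodule.mem_colon_singleton, smul_eq_mul, mul_assoc]⟩
  rw [IsLocalization.mk'_eq_mul_mk'_one]
  exact Ideal.mul_mem_right _ _ h2

theorem Ideal.map_map_frobenius {S : Type*} [CommRing S] [CharP S p] (φ : R →+* S)
    (J : Ideal R) : (J.map (frobenius R p)).map φ = (J.map φ).map (frobenius S p) := by
  rw [Ideal.map_map, Ideal.map_map]
  congr 1
  ext x
  simp [frobenius_def]

theorem IsRegularRing.mem_map_frobenius_colon [IsRegularRing R] {J : Ideal R} {s y : R}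
    (h : s ^ p * y ∈ J.map (frobenius R p)) : y ∈ (J.colon {s}).map (frobenius R p) := by
  refine Ideal.mem_of_localization_maximal fun P hP => ?_
  have : CharP (Localization.AtPrime P) p := charP_of_ringHom (algebraMap R _) p
  rw [Ideal.map_map_frobenius]
  refine Ideal.map_mono (IsLocalization.colon_map_le P.primeCompl J s) ?_
  refine (IsRegularLocalRing.frobeniusRelationsSpan (Localization.AtPrime P) p).mem_map_colon ?_
  rw [← Ideal.map_map_frobenius, ← map_pow, ← map_mul]
  exact Ideal.mem_map_of_mem _ h

variable (p) in
theorem frobeniusPower_add (J : Ideal R) (d e : ℕ) :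
    frobeniusPower p J (d + e) = frobeniusPower p (frobeniusPower p J d) e := by
  rw [frobeniusPower, frobeniusPower, frobeniusPower, Ideal.map_map]
  congr 1
  ext x
  simp [iterateFrobenius_def, pow_add, pow_mul]

variable (p) in
theorem frobeniusPower_succ (J : Ideal R) (e : ℕ) :
    frobeniusPower p J (e + 1) = (frobeniusPower p J e).map (frobenius R p) := by
  rw [frobeniusPower_add, frobeniusPower, iterateFrobenius_one]

theorem IsRegularRing.mem_frobeniusPower_colon [IsRegularRing R] {J : Ideal R} {s : R} (e : ℕ) :
    ∀ {y : R}, s ^ p ^ e * y ∈ frobeniusPower p J e → y ∈ frobeniusPower p (J.colon {s}) e := by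
  induction e with
  | zero =>
    intro y h
    have h0 : iterateFrobenius R p 0 = RingHom.id R := by ext; simp
    rw [frobeniusPower, h0, Ideal.map_id] at h ⊢
    rwa [Submodule.mem_colon_singleton, smul_eq_mul, mul_comm, ← pow_one s, ← pow_zero p]
  | succ e ih =>
    intro y h
    rw [frobeniusPower_succ] at h ⊢
    rw [pow_succ, pow_mul] at h
    refine Ideal.map_mono (fun z hz => ih ?_) (IsRegularRing.mem_map_frobenius_colon h)
    rwa [Submodule.mem_colon_singleton, smul_eq_mul, mul_comm] at hz

/-- Taking `s = x`, `y = 1` gives `1 ∈ (J : x)^[p] ⊆ J : x`. -/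
theorem IsRegularRing.mem_of_pow_mem_map_frobenius [IsRegularRing R] {J : Ideal R} {x : R}
    (h : x ^ p ∈ J.map (frobenius R p)) : x ∈ J := by
  by_contra hx
  have hne : J.colon {x} ≠ ⊤ := by
    rw [Ne, Submodule.colon_eq_top_iff_subset]
    simpa using hx
  have h1 : (1 : R) ∈ (J.colon {x}).map (frobenius R p) :=
    IsRegularRing.mem_map_frobenius_colon (by rwa [mul_one])
  refine hne ((Ideal.eq_top_iff_one _).2 (Ideal.map_le_iff_le_comap.2 (fun z hz => ?_) h1))
  rw [Ideal.mem_comap, frobenius_def]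
  exact Ideal.pow_mem_of_mem _ hz _ (Fact.out : p.Prime).pos

end FrobeniusColon

/-! ### Linear containment and growth of `ν` -/

section SymbolicContainment

variable {R : Type*} [CommRing R] {p : ℕ} [Fact p.Prime] [CharP R p]

theorem Ideal.span_pow_card_mul_add_one_le {K : Ideal R} (q : ℕ) (T : Finset R)
    (hT : ∀ t ∈ T, t ^ q ∈ K) : Ideal.span (T : Set R) ^ (T.card * q + 1) ≤ K := by
  classical
  induction T using Finset.induction_on with
  | empty => simp
  | insert g T hg ih =>
    rw [Finset.coe_insert, Ideal.span_insert, Finset.card_insert_of_notMem hg,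
      show (T.card + 1) * q + 1 = q + (T.card * q + 1) by ring]
    refine Ideal.sup_pow_add_le_pow_sup_pow.trans (sup_le ?_ (ih fun t ht => hT t (by simp [ht])))
    rw [Ideal.span_singleton_pow, Ideal.span_singleton_le_iff_mem]
    exact hT g (by simp)

variable (p) in
theorem exists_pow_mul_le_frobeniusPower [IsNoetherianRing R] (a : Ideal R) :
    ∃ N : ℕ, ∀ e, a ^ (N * p ^ e) ≤ frobeniusPower p a e := by
  obtain ⟨T, hT⟩ := IsNoetherian.noetherian a
  have hTa : a = Ideal.span (T : Set R) := hT.symm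
  refine ⟨T.card + 1, fun e => ?_⟩
  have h1 : ∀ t ∈ T, t ^ p ^ e ∈ frobeniusPower p a e := fun t ht =>
    Ideal.mem_map_of_mem (iterateFrobenius R p e) (hT ▸ Submodule.subset_span ht)
  have h2 := Ideal.span_pow_card_mul_add_one_le _ T h1
  rw [← hTa] at h2
  refine (Ideal.pow_le_pow_right ?_).trans h2
  have : 0 < p ^ e := pow_pos (Fact.out : p.Prime).pos e
  linarith [add_mul T.card 1 (p ^ e)]

/-- Prime avoidance yields `s` with `s x ∈ 𝔞^[q]` outside all associated primes of `𝔞`. Hence `𝔞 : s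
= 𝔞`, and `s ^ q x ∈ 𝔞^[q]` gives `x ∈ (𝔞 : s)^[q] = 𝔞^[q]`. -/
theorem symbolicPower_le_frobeniusPower [IsRegularRing R] {a : Ideal R} {e k : ℕ}
    (hk : a ^ k ≤ frobeniusPower p a e) : symbolicPower a k ≤ frobeniusPower p a e := by
  intro x hx
  obtain ⟨s, hs, hsP⟩ : ∃ s ∈ (frobeniusPower p a e).colon {x},
      ∀ P ∈ associatedPrimes R (R ⧸ a), s ∉ P := by
    by_contra! h
    obtain ⟨P, hP, hle⟩ := (Ideal.subset_union_prime_finite (f := id)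
      (associatedPrimes.finite R (R ⧸ a)) ⊥ ⊥ fun P hP _ _ => IsAssociatedPrime.isPrime hP).1
      fun s hs => by
        obtain ⟨P, hP, hsP⟩ := h s hs
        exact Set.mem_biUnion hP hsP
    have hPp : P.IsPrime := IsAssociatedPrime.isPrime hP
    have h1 : x ∈ localContraction (a ^ k) P := (Ideal.mem_iInf.1 hx) ⟨P, hP⟩
    have h2 := Ideal.map_mono (f := algebraMap R (Localization.AtPrime P)) hk h1
    obtain ⟨u, hu, hux⟩ :=
      (IsLocalization.algebraMap_mem_map_algebraMap_iff P.primeCompl _ _ _).1 h2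
    exact hu (hle (Submodule.mem_colon_singleton.2 hux))
  have hcolon : a.colon {s} ≤ a := by
    intro z hz
    rw [Submodule.mem_colon_singleton, smul_eq_mul] at hz
    by_contra hza
    have : s ∈ {r : R | ∃ m : R ⧸ a, m ≠ 0 ∧ r • m = 0} := by
      refine ⟨Ideal.Quotient.mk a z, by rwa [Ne, Ideal.Quotient.eq_zero_iff_mem], ?_⟩
      have := Ideal.Quotient.eq_zero_iff_mem.2 hz
      rwa [mul_comm, map_mul] at this
    rw [← biUnion_associatedPrimes_eq_zero_divisors] at this
    simp only [Set.mem_iUnion] at this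
    obtain ⟨P, hP, hsp⟩ := this
    exact hsP P hP hsp
  refine Ideal.map_mono hcolon (IsRegularRing.mem_frobeniusPower_colon e (s := s) ?_)
  rw [Submodule.mem_colon_singleton, smul_eq_mul] at hs
  obtain ⟨d, hd⟩ := Nat.exists_eq_succ_of_ne_zero (pow_pos (Fact.out : p.Prime).pos e).ne'
  rw [hd, pow_succ, mul_assoc]
  exact Ideal.mul_mem_left _ _ hs

theorem symbolicPower_antitone (a : Ideal R) : Antitone (symbolicPower a) :=
  antitone_nat_of_succ_le (symbolicFiltration a).ideal_succ_le

theorem exists_symbolicPower_le_frobeniusPower [IsRegularRing R] {a I : Ideal R}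
    (haI : a ≤ I.radical) :
    ∃ C : ℕ, ∀ e r, C * p ^ e ≤ r → symbolicPower a r ≤ frobeniusPower p I e := by
  obtain ⟨n, hn⟩ := Ideal.exists_pow_le_of_le_radical_of_fg haI (IsNoetherian.noetherian a)
  -- With `𝔞 ^ n ⊆ I` and `n < p ^ n`, one has `𝔞^[p^n] ⊆ I`; this accounts for the factor `p ^ n`
  -- in `C`.
  obtain ⟨N, hN⟩ := exists_pow_mul_le_frobeniusPower p a
  refine ⟨N * p ^ n, fun e r hr => ?_⟩
  have h1 : frobeniusPower p a n ≤ I := by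
    refine le_trans (Ideal.map_le_iff_le_comap.2 fun z hz => ?_) hn
    rw [Ideal.mem_comap, iterateFrobenius_def]
    exact Ideal.pow_le_pow_right (Nat.lt_pow_self (Fact.out : p.Prime).one_lt).le
      (Ideal.pow_mem_pow hz _)
  have h2 : frobeniusPower p a (n + e) ≤ frobeniusPower p I e := by
    rw [frobeniusPower_add]; exact Ideal.map_mono h1
  refine le_trans (symbolicPower_antitone a ?_) ((symbolicPower_le_frobeniusPower (hN _)).trans h2)
  rwa [pow_add, ← mul_assoc]

theorem IdealFiltration.pow_mem_ideal (a : IdealFiltration R) {r : ℕ} {x : R}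
    (hx : x ∈ a.ideal r) (k : ℕ) : x ^ k ∈ a.ideal (k * r) := by
  induction k with
  | zero => simp [a.ideal_zero]
  | succ k ih =>
    rw [pow_succ, add_mul, one_mul]
    exact a.ideal_mul_le _ _ (Ideal.mul_mem_mul ih hx)

theorem not_ideal_mul_le_frobeniusPower_succ [IsRegularRing R] {I : Ideal R}
    (a : IdealFiltration R) {e r : ℕ} (h : ¬ a.ideal r ≤ frobeniusPower p I e) :
    ¬ a.ideal (p * r) ≤ frobeniusPower p I (e + 1) := by
  obtain ⟨x, hx, hxI⟩ := Set.not_subset.1 h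
  refine fun hle => hxI (IsRegularRing.mem_of_pow_mem_map_frobenius (p := p) ?_)
  rw [← frobeniusPower_succ]
  exact hle (a.pow_mem_ideal hx p)

end SymbolicContainment

/-! ### Convergence of the normalized sequence -/

theorem biSup_natCast_eq_sSup {S : Set ℕ} (hne : S.Nonempty) (hb : BddAbove S) :
    ⨆ r ∈ S, (r : EReal) = ((sSup S : ℕ) : EReal) :=
  le_antisymm (iSup₂_le fun r hr => by exact_mod_cast le_csSup hb hr)
    (le_iSup₂ (f := fun (r : ℕ) (_ : r ∈ S) => (r : EReal)) _ (Nat.sSup_mem hne hb))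

/-- If `ν(p ^ e)` grows at least by a factor `p` and is at most linear in `p ^ e`, the F-threshold
exists. -/
theorem IdealFiltration.exists_isFThreshold {R : Type*} [CommRing R] (p : ℕ) [Fact p.Prime]
    [CharP R p] {I : Ideal R} (a : IdealFiltration R) (hI : I ≠ ⊤)
    (hmul : ∀ e r, ¬ a.ideal r ≤ frobeniusPower p I e →
      ¬ a.ideal (p * r) ≤ frobeniusPower p I (e + 1))
    (hbdd : ∃ C : ℕ, ∀ e r, C * p ^ e ≤ r → a.ideal r ≤ frobeniusPower p I e) :
    ∃ c : ℝ, IsFThreshold p I a c := by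
  obtain ⟨C, hC⟩ := hbdd
  have hp : p.Prime := Fact.out
  have hp0 : (0 : ℝ) < p := by exact_mod_cast hp.pos
  let S : ℕ → Set ℕ := fun e => {r | ¬ a.ideal r ≤ frobeniusPower p I e}
  have hlt : ∀ e, ∀ r ∈ S e, r ≤ C * p ^ e := fun e r hr => by
    by_contra! h
    exact hr (hC e r h.le)
  have hb : ∀ e, BddAbove (S e) := fun e => ⟨C * p ^ e, hlt e⟩
  -- Since `I` is proper, `r = 0` always belongs to the set, so `ν` never takes the value `⊥`.
  have hne : ∀ e, (S e).Nonempty := fun e => ⟨0, fun h => by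
    rw [a.ideal_zero, top_le_iff] at h
    have h1 : frobeniusPower p I e ≤ I := Ideal.map_le_iff_le_comap.2 fun z hz => by
      rw [Ideal.mem_comap, iterateFrobenius_def]
      exact Ideal.pow_mem_of_mem _ hz _ (pow_pos hp.pos e)
    exact hI (top_le_iff.1 (h ▸ h1))⟩
  let u : ℕ → ℝ := fun e => (sSup (S e) : ℕ) / (p : ℝ) ^ e
  have hu : ∀ e, frobeniusNu p I a e / (((p : ℝ) ^ e : ℝ) : EReal) = (u e : EReal) := fun e => by
    have : frobeniusNu p I a e = ((sSup (S e) : ℕ) : EReal) := biSup_natCast_eq_sSup (hne e) (hb e)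
    rw [this, EReal.coe_div]
    rfl
  have hmono : Monotone u := monotone_nat_of_le_succ fun e => by
    have h1 : p * sSup (S e) ≤ sSup (S (e + 1)) :=
      le_csSup (hb _) (hmul e _ (Nat.sSup_mem (hne e) (hb e)))
    have h2 : (p : ℝ) * (sSup (S e) : ℕ) ≤ (sSup (S (e + 1)) : ℕ) := by exact_mod_cast h1
    simp only [u]
    rw [div_le_div_iff₀ (by positivity) (by positivity), pow_succ]
    nlinarith [pow_pos hp0 e]
  have hbdd : BddAbove (Set.range u) := ⟨C, by
    rintro _ ⟨e, rfl⟩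
    simp only [u]
    rw [div_le_iff₀ (by positivity)]
    exact_mod_cast hlt e _ (Nat.sSup_mem (hne e) (hb e))⟩
  have htend : Tendsto (fun e => (u e : EReal)) atTop (nhds ((⨆ e, u e : ℝ) : EReal)) :=
    (continuous_coe_real_ereal.tendsto _).comp (tendsto_atTop_ciSup hmono hbdd)
  refine ⟨⨆ e, u e, Real.iSup_nonneg fun e => by positivity, ?_, ?_⟩
  · simp only [upperFThreshold, hu]
    exact htend.limsup_eq
  · simp only [lowerFThreshold, hu]
    exact htend.liminf_eq

theorem theorem3p13 {R : Type*} [CommRing R] [IsRegularRing R] (p : ℕ) [Fact p.Prime] [CharP R p]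
    (a I : Ideal R) (ha : a ≠ ⊥) (ha' : a ≠ ⊤) (hI : I ≠ ⊥) (hI' : I ≠ ⊤)
    (haI : a ≤ I.radical) :
    ∃ c : ℝ, IsFThreshold p I (symbolicFiltration a) c :=
  (symbolicFiltration a).exists_isFThreshold p hI'
    (fun _ _ => not_ideal_mul_le_frobeniusPower_succ _)
    (exists_symbolicPower_le_frobeniusPower haI)
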